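/- Let $T$ be the unrooted dyadic tree, i.e. the infinite tree (with vertex set also denoted $T$ and edge set $E$) in which every vertex is an endpoint of exactly three edges. Let $\partial T$ be its boundary (geodesic rays, two rays being identified if they eventually coincide up to a shift) and $\overline T=T\cup\partial T$. Removing an edge from $T$ leaves two subtrees; each of them, together with the boundary points of its rays, is called a tent, and the set of boundary points of a tent is called an arc. Equip $\overline T$ with the topology generated by the tents and the singletons $\{x\}$, $x\in T$. For $F:\overline T\to\mathbb R$ and an edge $\alpha=\{x,y\}$ put $|\nabla F(\alpha)|=|F(x)-F(y)|$. We say that $F$ has a radial limit at $\xi\in\partial T$ if $F(x_n)\to F(\xi)$ for every geodesic ray $(x_n)$ converging to $\xi$. For a Borel probability measure $\mu$ on $\overline T$ and a vertex $o\in T$, let $[\mu]_o\in[0,\infty]$ be the best constant in $$\int_{\overline T}|F|^2\,d\mu\le[\mu]_o\Big(|F(o)|^2+\sum_{\alpha\in E}|\nabla F(\alpha)|^2\Big),$$ and let $[\mu]_{inv}\in[0,\infty]$ be the best constant in $$\int_{\overline T}\Big|F-\int_{\overline T} F\,d\mu\Big|^2d\mu\le[\mu]_{inv}\sum_{\alpha\in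 E}|\nabla F(\alpha)|^2,$$ in both cases for all $F:\overline T\to\mathbb R$ that have a radial limit at $\mu$-almost every boundary point (the left-hand side of the second inequality is $+\infty$ if $F\notin L^2(\mu)$). For disjoint $A,B\subseteq\partial T$, each a finite union of arcs, let $$\mathrm{Cap}(A,B)=\inf\Big\{\sum_{\alpha\in E}|\nabla F(\alpha)|^2:\ F|_A=1,\ F|_B=0,\ |\nabla F|\text{ has finite support}\Big\},$$ where $F:\overline T\to\mathbb R$ has a radial limit at every boundary point. Theorem. There is an absolute constant $C\in(0,\infty)$ such that for every Borel probability measure $\mu$ on $\overline T$ that gives no mass to vertices and is not a Dirac delta at a point of $\partial T$, $$C^{-1}\inf_{o\in T}[\mu]_o\le[\mu]_{inv}\le C\inf_{o\in T}[\mu]_o,\qquad C^{-1}\inf_{o\in T}[\mu]_o\le\sup_{A,B}\frac{\mu(A)\mu(B)}{\mathrm{Cap}(A,B)}\le C\inf_{o\in T}[\mu]_o,$$ where the supremum is over all pairs of disjoint subsets $A,B\subseteq\partial T$ each of which is a finite union of arcs (with $0/0=0$ if $A$ or $B$ is empty), and the three quantities may be $+\infty$. -/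

import Mathlib

open MeasureTheory Filter
open scoped ENNReal NNReal Topology

namespace TreeHardy

universe u

variable {V : Type u}

/-- A geodesic ray of a tree `G`: an infinite path that never visits a vertex twice. -/
structure Ray (G : SimpleGraph V) where
  toFun : ℕ → V
  adj : ∀ n, G.Adj (toFun n) (toFun (n + 1))
  inj : Function.Injective toFun

/-- Two rays are equivalent if they agree from some point on, up to a shift of the index. -/
def raySetoid (G : SimpleGraph V) : Setoid (Ray G) where
  r r s := ∃ m n : ℕ, ∀ k : ℕ, r.toFun (m + k) = s.toFun (n + k)
  iseqv :=
    { refl := fun _ => ⟨0, 0, fun _ => rfl⟩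
      symm := fun ⟨m, n, h⟩ => ⟨n, m, fun k => (h k).symm⟩
      trans := by
        rintro r s t ⟨m, n, h⟩ ⟨m', n', h'⟩
        refine ⟨m + m', n' + n, fun k => ?_⟩
        have h1 := h (m' + k)
        have h2 := h' (n + k)
        rw [← add_assoc] at h1
        rw [h1, add_assoc n' n k, ← h2]
        congr 1
        omega }

/-- The boundary `∂T`: geodesic rays up to equivalence. In a tree, every boundary point is
represented by exactly one ray issued from any given vertex. -/
def Boundary (G : SimpleGraph V) : Type u := Quotient (raySetoid G)

/-- The boundary point that a ray converges to. -/
def Ray.endpoint {G : SimpleGraph V} (r : Ray G) : Boundary G := Quotient.mk (raySetoid G) r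

/-- The space `T ∪ ∂T` of vertices and boundary points. -/
inductive TBar (G : SimpleGraph V) : Type u
  | vertex : V → TBar G
  | bdry : Boundary G → TBar G

/-- The vertices on the far side of the oriented edge `d`: those closer to its head `d.snd` than
to its tail `d.fst`. In a tree, removing the edge leaves two components, and this is the one that
contains the head; it is the rooted subtree with root `d.snd` and pre-root `d.fst`. -/
def side {G : SimpleGraph V} (d : G.Dart) : Set V :=
  {x | G.dist x d.snd < G.dist x d.fst}

/-- The arc of the oriented edge `d`: the boundary points whose rays end up on the far side
of `d`. -/
def arc {G : SimpleGraph V} (d : G.Dart) : Set (Boundary G) :=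
  {ξ | ∃ r : Ray G, r.endpoint = ξ ∧ ∀ᶠ n in atTop, r.toFun n ∈ side d}

/-- The tent (successor set) of the oriented edge `d` in `T ∪ ∂T`. -/
def tent {G : SimpleGraph V} (d : G.Dart) : Set (TBar G) :=
  TBar.vertex '' side d ∪ TBar.bdry '' arc d

/-- The topology of `T ∪ ∂T` generated by the tents and the singletons of vertices. -/
instance (G : SimpleGraph V) : TopologicalSpace (TBar G) :=
  TopologicalSpace.generateFrom
    (Set.range (fun d : G.Dart => tent d) ∪ Set.range (fun v : V => {TBar.vertex v}))

instance (G : SimpleGraph V) : MeasurableSpace (TBar G) := borel (TBar G)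

instance (G : SimpleGraph V) : BorelSpace (TBar G) := ⟨rfl⟩

/-- `|∇F(α)|²`, the squared difference of the values of `F` at the two endpoints of the
edge `α`. -/
noncomputable def sqGrad {G : SimpleGraph V} (F : TBar G → ℝ) (α : Sym2 V) : ℝ≥0∞ :=
  Sym2.lift ⟨fun x y => ENNReal.ofReal ((F (.vertex x) - F (.vertex y)) ^ 2), fun _ _ =>
    congrArg ENNReal.ofReal (by ring)⟩ α

/-- The Dirichlet sum of `|∇F(α)|²` over all (unoriented) edges `α`. -/
noncomputable def energy {G : SimpleGraph V} (F : TBar G → ℝ) : ℝ≥0∞ :=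
  ∑' α : G.edgeSet, sqGrad F α

/-- The value of `F` at the boundary point `ξ` is the limit of its values at the vertices along
the geodesics that converge to `ξ`. -/
def HasRadialLimit {G : SimpleGraph V} (F : TBar G → ℝ) (ξ : Boundary G) : Prop :=
  ∀ r : Ray G, r.endpoint = ξ →
    Tendsto (fun n => F (.vertex (r.toFun n))) atTop (𝓝 (F (.bdry ξ)))

/-- The functions on `T ∪ ∂T` that are tested in the Hardy inequalities: at `μ`-almost every
boundary point, the value is the radial limit of the values at the vertices. -/
def Admissible {G : SimpleGraph V} (μ : Measure (TBar G)) (F : TBar G → ℝ) : Prop :=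
  ∀ᵐ x ∂μ, ∀ ξ : Boundary G, x = .bdry ξ → HasRadialLimit F ξ

/-- The best constant `[μ]_o` in the Hardy inequality with root `o`,
`∫ |F|² dμ ≤ [μ]_o (|F(o)|² + ∑ |∇F(α)|²)`. -/
noncomputable def hardyConst {G : SimpleGraph V} (μ : Measure (TBar G)) (o : V) : ℝ≥0∞ :=
  sInf {C : ℝ≥0∞ | ∀ F : TBar G → ℝ, Admissible μ F →
    ∫⁻ x, ENNReal.ofReal (F x ^ 2) ∂μ ≤
      C * (ENNReal.ofReal (F (.vertex o) ^ 2) + energy F)}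

/-- The best constant `[μ]_inv` in the conformally invariant Hardy inequality
`∫ |F - μ(F)|² dμ ≤ [μ]_inv ∑ |∇F(α)|²`. The left-hand side is the extended variance of `F`, which
is infinite when `F` is not in `L²(μ)`. -/
noncomputable def invHardyConst {G : SimpleGraph V} (μ : Measure (TBar G)) : ℝ≥0∞ :=
  sInf {C : ℝ≥0∞ | ∀ F : TBar G → ℝ, Admissible μ F →
    ProbabilityTheory.evariance F μ ≤ C * energy F}

/-- Finite unions of arcs. -/
def IsFiniteUnionOfArcs {G : SimpleGraph V} (A : Set (Boundary G)) : Prop :=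
  ∃ s : Set G.Dart, s.Finite ∧ A = ⋃ d ∈ s, arc d

/-- The capacity of the condenser `(A, B)`. -/
noncomputable def condenserCap {G : SimpleGraph V} (A B : Set (Boundary G)) : ℝ≥0∞ :=
  sInf {c : ℝ≥0∞ | ∃ F : TBar G → ℝ, (∀ ξ, HasRadialLimit F ξ) ∧
    (∀ ξ ∈ A, F (.bdry ξ) = 1) ∧ (∀ ξ ∈ B, F (.bdry ξ) = 0) ∧
    {α : Sym2 V | α ∈ G.edgeSet ∧ sqGrad F α ≠ 0}.Finite ∧ c = energy F}

/-- The supremum of `μ(A) μ(B) / Cap(A, B)` over all pairs of disjoint finite unions of arcs. If one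
of the two sets is empty, the quotient is `0 / 0 = 0`; otherwise the capacity is a positive real. -/
noncomputable def condenserSup {G : SimpleGraph V} (μ : Measure (TBar G)) : ℝ≥0∞ :=
  ⨆ (A : Set (Boundary G)) (B : Set (Boundary G)) (_ : IsFiniteUnionOfArcs A)
    (_ : IsFiniteUnionOfArcs B) (_ : Disjoint A B),
    μ (TBar.bdry '' A) * μ (TBar.bdry '' B) / condenserCap A B

end TreeHardy

/-!
The three quantities satisfy `sup μ(A) μ(B) / Cap(A, B) ≤ [μ]_inv ≤ [μ]_o` for every root `o`, the
first because a function that is `1` on `A` and `0` on `B` has variance at least `μ(A) μ(B)`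
(`condenserSup_le_invHardyConst`), the second because the variance is at most the second moment
about `F(o)` (`invHardyConst_le_hardyConst`). What remains is to bound `[μ]_o` by a multiple of the
condenser supremum `S` for a well chosen root.

The root is a median vertex `o`: each of the three arcs seen from `o` has mass at most `1 / 2`. If
there is none, following the edges that point to more than half of the mass gives a ray whose
endpoint has mass at least `1 / 2`, and since `μ` is not a Dirac mass, small arcs around that
endpoint give `S = ∞` (`condenserSup_eq_top_of_forall_exists`).

At a median vertex, the condenser of a suitable edge at `o` gives `S ≥ 1 / 6`, which takes care of
the term `|F(o)|²` (`one_le_condenserSup_of_median`). For the rest, `F - F(o)` is cut into its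
restrictions to the three branches at `o`. On each branch Maz'ya's capacitary argument applies
(`lintegral_sq_le_condenserSup_mul_energy`): the complementary arc `B` has mass at least `1 / 2`,
so that the mass of a superlevel set `A` is at most `2 μ(A) μ(B) ≤ 2 S Cap(A, B)`; the capacities of
the dyadic superlevel sets are bounded by the energies of the dyadic parts of the function, and
these add up to at most its energy (`tsum_energy_dyadicPart_le`).

To have only finite unions of arcs and finitely supported gradients, the functions are first
composed with the projection `proj` of `T ∪ ∂T` onto the ball of radius `n` around `o`. This does not
increase the energy, and Fatou's lemma allows `n → ∞`. The geometry of the tree enters through one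
fact: only the edge of `d` joins the two sides of `d` (`edge_eq_of_mem_side`).
-/

open MeasureTheory Filter
open scoped ENNReal NNReal Topology

namespace TreeHardy

universe u

variable {V : Type u} {G : SimpleGraph V}

/-! ### The two sides of an edge, and parents with respect to a root -/

lemma dist_lt_of_mem_support {x y z : V} (p : G.Walk x y)
    (hp : p.length = G.dist x y) (hz : z ∈ p.support) (hzy : z ≠ y) :
    G.dist x z < G.dist x y := by
  classical
  rw [← hp]
  exact (G.dist_le (p.takeUntil z hz)).trans_lt (p.length_takeUntil_lt_length hz hzy)

/-- In a tree, an edge that joins the far side of `d` to its complement is the edge of `d` itself: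
otherwise one could go round the edge of `d`, which is a bridge. -/
lemma edge_eq_of_mem_side (hG : G.IsTree) (d : G.Dart) {y z : V} (hyz : G.Adj y z)
    (hy : y ∈ side d) (hz : z ∉ side d) : s(y, z) = d.edge := by
  classical
  obtain ⟨p, hp⟩ := hG.connected.exists_walk_length_eq_dist y d.snd
  obtain ⟨q, hq⟩ := hG.connected.exists_walk_length_eq_dist z d.fst
  have hb := SimpleGraph.isAcyclic_iff_forall_adj_isBridge.1 hG.isAcyclic d.adj
  rw [SimpleGraph.isBridge_iff_forall_walk_mem_edges] at hb
  have hmem := hb ((p.reverse.append (.cons hyz q)).reverse)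
  have hed : d.edge = s(d.fst, d.snd) := rfl
  simp only [SimpleGraph.Walk.edges_reverse, SimpleGraph.Walk.edges_append,
    SimpleGraph.Walk.edges_cons, List.mem_reverse, List.mem_append, List.mem_cons] at hmem
  simp only [side, Set.mem_ofPred_eq, not_lt] at hy hz
  rcases hmem with h | h | h
  · have := dist_lt_of_mem_support p hp (p.fst_mem_support_of_mem_edges h) d.adj.ne
    omega
  · rw [hed, h]
  · have := dist_lt_of_mem_support q hq (q.snd_mem_support_of_mem_edges h) d.adj.ne'
    omega

lemma mem_side_iff_of_adj (hG : G.IsTree) (d : G.Dart) {y z : V} (hyz : G.Adj y z)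
    (hne : s(y, z) ≠ d.edge) : y ∈ side d ↔ z ∈ side d := by
  constructor
  · intro h
    by_contra h'
    exact hne (edge_eq_of_mem_side hG d hyz h h')
  · intro h
    by_contra h'
    exact hne (Sym2.eq_swap.trans (edge_eq_of_mem_side hG d hyz.symm h h'))

lemma snd_mem_side (d : G.Dart) : d.snd ∈ side d := by
  simp only [side, Set.mem_ofPred_eq, SimpleGraph.dist_self]
  rw [SimpleGraph.dist_comm, SimpleGraph.dist_eq_one_iff_adj.2 d.adj]
  exact one_pos

lemma fst_notMem_side (d : G.Dart) : d.fst ∉ side d := by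
  simp [side]

lemma mem_side_symm_iff (hG : G.IsTree) (d : G.Dart) (x : V) : x ∈ side d.symm ↔ x ∉ side d := by
  have := hG.dist_ne_of_adj x d.adj
  change G.dist x d.fst < G.dist x d.snd ↔ ¬ (G.dist x d.snd < G.dist x d.fst)
  omega

lemma exists_adj_dist_eq (hG : G.IsTree) (o : V) {x : V} (hx : x ≠ o) :
    ∃ y, G.Adj x y ∧ G.dist o x = G.dist o y + 1 := by
  obtain ⟨p, hp⟩ := hG.connected.exists_walk_length_eq_dist x o
  cases p with
  | nil => exact absurd rfl hx
  | @cons _ y _ h q =>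
    refine ⟨y, h, ?_⟩
    have h1 := G.dist_le q
    have h2 := hG.dist_eq_dist_add_one_of_adj o h
    rw [SimpleGraph.Walk.length_cons, SimpleGraph.dist_comm] at hp
    rw [SimpleGraph.dist_comm] at h1
    omega

/-- The far side of an edge pointing away from the root contains no other vertex at most as far
from the root as its head. -/
lemma notMem_side_of_dist_le (hG : G.IsTree) (o : V) (d : G.Dart)
    (hd : G.dist o d.snd = G.dist o d.fst + 1) (y : V) (hy : G.dist o y ≤ G.dist o d.snd)
    (hne : y ≠ d.snd) : y ∉ side d := by
  induction hn : G.dist o y generalizing y with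
  | zero =>
    have : o = y := (hG.connected.dist_eq_zero_iff).1 hn
    subst this
    simp [side, hd]
  | succ n ih =>
    have hyo : y ≠ o := by
      rintro rfl
      simp at hn
    obtain ⟨z, hyz, hz⟩ := exists_adj_dist_eq hG o hyo
    have hzs : z ≠ d.snd := by
      rintro rfl
      omega
    have hzd := ih z (by omega) hzs (by omega)
    refine fun h => hzd ((mem_side_iff_of_adj hG d hyz fun he => ?_).1 h)
    have : d.snd ∈ s(y, z) := by
      rw [he]
      exact Sym2.mem_mk_right _ _
    rcases Sym2.mem_iff.1 this with h | h
    · exact hne h.symm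
    · exact hzs h.symm

/-- At most one neighbor is closer to the root. -/
lemma eq_of_adj_of_dist_eq (hG : G.IsTree) (o : V) {x y z : V} (hy : G.Adj x y) (hz : G.Adj x z)
    (hdy : G.dist o x = G.dist o y + 1) (hdz : G.dist o x = G.dist o z + 1) : y = z := by
  by_contra hne
  let d : G.Dart := ⟨(y, x), hy.symm⟩
  have h1 : z ∉ side d := notMem_side_of_dist_le hG o d hdy z
    (show G.dist o z ≤ G.dist o x by omega) hz.ne'
  refine h1 ((mem_side_iff_of_adj hG d hz fun he => ?_).1 (snd_mem_side d))
  have : z ∈ s(y, x) := by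
    rw [show s(y, x) = d.edge from rfl, ← he]
    exact Sym2.mem_mk_right _ _
  rcases Sym2.mem_iff.1 this with h | h
  · exact hne h.symm
  · exact hz.ne' h

open Classical in
/-- The neighbor of `x` that is closer to the root `o`; the root is its own parent. -/
noncomputable def parent (G : SimpleGraph V) (o x : V) : V :=
  if h : ∃ y, G.Adj x y ∧ G.dist o x = G.dist o y + 1 then h.choose else x

lemma parent_spec (hG : G.IsTree) (o : V) {x : V} (hx : x ≠ o) :
    G.Adj x (parent G o x) ∧ G.dist o x = G.dist o (parent G o x) + 1 := by
  have h := exists_adj_dist_eq hG o hx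
  rw [parent, dif_pos h]
  exact h.choose_spec

lemma parent_eq (hG : G.IsTree) (o : V) {x y : V} (h : G.Adj x y)
    (hd : G.dist o x = G.dist o y + 1) : parent G o x = y := by
  have hx : x ≠ o := by
    rintro rfl
    simp at hd
  exact eq_of_adj_of_dist_eq hG o (parent_spec hG o hx).1 h (parent_spec hG o hx).2 hd

/-- The projection of `x` onto the ball of radius `n` around the root `o`: the point of the
geodesic from `o` to `x` at distance `n` from `o`, or `x` itself if it lies in the ball. -/
noncomputable def trunc (G : SimpleGraph V) (o : V) (n : ℕ) (x : V) : V :=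
  (parent G o)^[G.dist o x - n] x

lemma trunc_of_le (o : V) {n : ℕ} {x : V} (h : G.dist o x ≤ n) : trunc G o n x = x := by
  simp [trunc, Nat.sub_eq_zero_of_le h]

lemma trunc_eq_of_adj (hG : G.IsTree) (o : V) {n : ℕ} {x y : V} (h : G.Adj x y)
    (hd : G.dist o x = G.dist o y + 1) (hn : n ≤ G.dist o y) :
    trunc G o n x = trunc G o n y := by
  have : G.dist o x - n = (G.dist o y - n) + 1 := by omega
  rw [trunc, trunc, this, Function.iterate_succ_apply, parent_eq hG o h hd]

/-- Induction from a vertex beyond the ball of radius `n` down to the sphere. -/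
lemma trunc_induction (hG : G.IsTree) (o : V) (n : ℕ) {P : V → Prop}
    (base : ∀ x, G.dist o x ≤ n → P x)
    (step : ∀ x y, G.Adj x y → G.dist o x = G.dist o y + 1 → n ≤ G.dist o y → P y → P x)
    (x : V) : P x := by
  induction hk : G.dist o x generalizing x with
  | zero => exact base x (by omega)
  | succ k ih =>
    by_cases hle : G.dist o x ≤ n
    · exact base x hle
    have hx : x ≠ o := by
      rintro rfl
      simp at hk
    obtain ⟨y, hxy, hy⟩ := exists_adj_dist_eq hG o hx
    exact step x y hxy hy (by omega) (ih y (by omega))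

lemma dist_trunc (hG : G.IsTree) (o : V) (n : ℕ) (x : V) :
    G.dist o (trunc G o n x) = min (G.dist o x) n := by
  induction x using trunc_induction hG o n with
  | base x h => rw [trunc_of_le o h, min_eq_left h]
  | step x y hxy hd hn ih => rw [trunc_eq_of_adj hG o hxy hd hn, ih]; omega

/-- Truncation does not cross the edges inside the ball. -/
lemma trunc_mem_side_iff (hG : G.IsTree) (o : V) {n : ℕ} (d : G.Dart)
    (h1 : G.dist o d.fst ≤ n) (h2 : G.dist o d.snd ≤ n) (x : V) :
    trunc G o n x ∈ side d ↔ x ∈ side d := by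
  induction x using trunc_induction hG o n with
  | base x h => rw [trunc_of_le o h]
  | step x y hxy hd hn ih =>
    rw [trunc_eq_of_adj hG o hxy hd hn, ih]
    refine (mem_side_iff_of_adj hG d hxy fun he => ?_).symm
    have : x ∈ s(d.fst, d.snd) := by
      rw [show s(d.fst, d.snd) = d.edge from rfl, ← he]
      exact Sym2.mem_mk_left _ _
    rcases Sym2.mem_iff.1 this with rfl | rfl <;> omega

lemma exists_dart_mem_side (hG : G.IsTree) {o x : V} (hx : x ≠ o) :
    ∃ d : G.Dart, d.fst = o ∧ x ∈ side d := by
  obtain ⟨y, hy, hd⟩ := exists_adj_dist_eq hG x hx.symm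
  refine ⟨⟨(o, y), hy⟩, rfl, ?_⟩
  change G.dist x y < G.dist x o
  omega

lemma finite_dist_le [G.LocallyFinite] (hG : G.IsTree) (o : V) (n : ℕ) :
    {x | G.dist o x ≤ n}.Finite := by
  induction n with
  | zero =>
    refine (Set.finite_singleton o).subset fun x hx => ?_
    exact ((hG.connected.dist_eq_zero_iff).1 (Nat.le_zero.1 hx)).symm
  | succ n ih =>
    refine (ih.union (ih.biUnion fun y _ => (Set.toFinite (G.neighborSet y)))).subset
      fun x hx => ?_
    by_cases hxo : x = o
    · left
      simp [hxo]
    obtain ⟨y, hxy, hy⟩ := exists_adj_dist_eq hG o hxo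
    have hx' : G.dist o x ≤ n + 1 := hx
    exact Or.inr (Set.mem_biUnion (show G.dist o y ≤ n by omega) hxy.symm)

lemma countable_of_isTree [G.LocallyFinite] (hG : G.IsTree) : Countable V := by
  obtain ⟨o⟩ := hG.connected.nonempty
  rw [← Set.countable_univ_iff]
  refine (Set.countable_iUnion fun n => (finite_dist_le hG o n).countable).mono
    fun x _ => Set.mem_iUnion.2 ⟨G.dist o x, le_refl (G.dist o x)⟩

/-! ### Rays seen from a root -/

/-- Once a path without backtracking moves away from the root, it does so forever. -/
lemma dist_eq_add_of_ne (hG : G.IsTree) (o : V) (r : ℕ → V) (hadj : ∀ n, G.Adj (r n) (r (n + 1)))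
    (hne : ∀ n, r (n + 2) ≠ r n) {N : ℕ} (hN : G.dist o (r (N + 1)) = G.dist o (r N) + 1) (k : ℕ) :
    G.dist o (r (N + k)) = G.dist o (r N) + k := by
  suffices h : ∀ k, G.dist o (r (N + k)) = G.dist o (r N) + k ∧
      G.dist o (r (N + (k + 1))) = G.dist o (r N) + (k + 1) from (h k).1
  intro k
  induction k with
  | zero => exact ⟨rfl, hN⟩
  | succ k ih =>
    refine ⟨ih.2, ?_⟩
    have ha : G.Adj (r (N + (k + 1))) (r (N + (k + 1 + 1))) := hadj (N + (k + 1))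
    rcases hG.dist_eq_dist_add_one_of_adj o ha with h | h
    · refine absurd ?_ (hne (N + k))
      exact eq_of_adj_of_dist_eq hG o ha (hadj (N + k)).symm h (by omega)
    · omega

/-- A ray cannot approach the root forever, so from some index on it moves away from it. -/
lemma Ray.exists_dist_eq (hG : G.IsTree) (o : V) (r : Ray G) :
    ∃ N, ∀ k, G.dist o (r.toFun (N + k)) = G.dist o (r.toFun N) + k := by
  have hne : ∀ n, r.toFun (n + 2) ≠ r.toFun n := fun n h => by
    have := r.inj h
    omega
  by_contra! hcon
  have hdec : ∀ n, G.dist o (r.toFun n) = G.dist o (r.toFun (n + 1)) + 1 := fun n => by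
    rcases hG.dist_eq_dist_add_one_of_adj o (r.adj n) with h | h
    · exact h
    · obtain ⟨k, hk⟩ := hcon n
      exact absurd (dist_eq_add_of_ne hG o r.toFun r.adj hne h k) hk
  have hsum : ∀ n, G.dist o (r.toFun n) + n = G.dist o (r.toFun 0) := fun n => by
    induction n with
    | zero => rfl
    | succ n ih =>
      have := hdec n
      omega
  have := hsum (G.dist o (r.toFun 0) + 1)
  omega

lemma Ray.trunc_eq (hG : G.IsTree) (o : V) (r : Ray G) {N : ℕ}
    (hN : ∀ k, G.dist o (r.toFun (N + k)) = G.dist o (r.toFun N) + k) (j i : ℕ) :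
    trunc G o (G.dist o (r.toFun N) + j) (r.toFun (N + j + i)) = r.toFun (N + j) := by
  induction i with
  | zero => exact trunc_of_le o (hN j).le
  | succ i ih =>
    have h1 := hN (j + i)
    have h2 := hN (j + (i + 1))
    rw [← add_assoc] at h1 h2
    rw [← ih]
    exact trunc_eq_of_adj hG o (r.adj _).symm (by rw [h1]; exact h2) (by omega)

lemma Ray.exists_eventually_trunc (hG : G.IsTree) (o : V) (n : ℕ) (r : Ray G) :
    ∃ v, G.dist o v = n ∧ ∀ᶠ k in atTop, trunc G o n (r.toFun k) = v := by
  obtain ⟨N, hN⟩ := r.exists_dist_eq hG o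
  have key : ∀ k, trunc G o n (r.toFun (N + n + k)) = trunc G o n (r.toFun (N + n)) := fun k => by
    induction k with
    | zero => rfl
    | succ k ih =>
      have h1 := hN (n + k)
      have h2 := hN (n + (k + 1))
      rw [← add_assoc] at h1 h2
      rw [← ih]
      exact trunc_eq_of_adj hG o (r.adj _).symm (by rw [h1]; exact h2) (by omega)
  refine ⟨trunc G o n (r.toFun (N + n)), ?_, eventually_atTop.2 ⟨N + n, fun k hk => ?_⟩⟩
  · rw [dist_trunc hG, hN]
    omega
  · obtain ⟨i, rfl⟩ := Nat.exists_eq_add_of_le hk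
    exact key i

lemma eventually_of_endpoint_eq {r s : Ray G} (h : r.endpoint = s.endpoint) {P : V → Prop}
    (hr : ∀ᶠ k in atTop, P (r.toFun k)) : ∀ᶠ k in atTop, P (s.toFun k) := by
  obtain ⟨m, n, hmn⟩ := Quotient.exact h
  obtain ⟨K, hK⟩ := eventually_atTop.1 hr
  refine eventually_atTop.2 ⟨n + K, fun k hk => ?_⟩
  obtain ⟨i, rfl⟩ := Nat.exists_eq_add_of_le hk
  rw [add_assoc, ← hmn]
  exact hK _ (by omega)

lemma exists_eventually_trunc (hG : G.IsTree) (o : V) (n : ℕ) (ξ : Boundary G) :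
    ∃ v, G.dist o v = n ∧
      ∀ r : Ray G, r.endpoint = ξ → ∀ᶠ k in atTop, trunc G o n (r.toFun k) = v := by
  induction ξ using Quotient.inductionOn with
  | h r =>
    obtain ⟨v, hv, hr⟩ := r.exists_eventually_trunc hG o n
    exact ⟨v, hv, fun s hs =>
      eventually_of_endpoint_eq (P := fun x => trunc G o n x = v) hs.symm hr⟩

open Classical in
/-- The projection of `T ∪ ∂T` onto the ball of radius `n` around the root `o`. A boundary point
is sent to the vertex at distance `n` on the geodesic from `o` that represents it. -/
noncomputable def proj (G : SimpleGraph V) (o : V) (n : ℕ) : TBar G → V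
  | .vertex x => trunc G o n x
  | .bdry ξ =>
    if h : ∃ v, G.dist o v = n ∧
      ∀ r : Ray G, r.endpoint = ξ → ∀ᶠ k in atTop, trunc G o n (r.toFun k) = v
    then h.choose else o

lemma proj_vertex (o : V) (n : ℕ) (x : V) : proj G o n (.vertex x) = trunc G o n x := rfl

lemma proj_bdry_spec (hG : G.IsTree) (o : V) (n : ℕ) (ξ : Boundary G) :
    G.dist o (proj G o n (.bdry ξ)) = n ∧ ∀ r : Ray G, r.endpoint = ξ →
      ∀ᶠ k in atTop, trunc G o n (r.toFun k) = proj G o n (.bdry ξ) := by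
  have h := exists_eventually_trunc hG o n ξ
  rw [proj, dif_pos h]
  exact h.choose_spec

lemma Boundary.exists_ray (ξ : Boundary G) : ∃ r : Ray G, r.endpoint = ξ := Quotient.exists_rep ξ

lemma proj_endpoint (hG : G.IsTree) (o : V) (r : Ray G) {N : ℕ}
    (hN : ∀ k, G.dist o (r.toFun (N + k)) = G.dist o (r.toFun N) + k) (j : ℕ) :
    proj G o (G.dist o (r.toFun N) + j) (.bdry r.endpoint) = r.toFun (N + j) := by
  obtain ⟨K, hK⟩ := eventually_atTop.1
    ((proj_bdry_spec hG o (G.dist o (r.toFun N) + j) r.endpoint).2 r rfl)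
  rw [← hK (N + j + K) (by omega), r.trunc_eq hG o hN]

/-- Membership in an arc is read off the projection onto any ball containing its edge. -/
lemma mem_arc_iff (hG : G.IsTree) (o : V) {n : ℕ} (d : G.Dart)
    (h1 : G.dist o d.fst ≤ n) (h2 : G.dist o d.snd ≤ n) (ξ : Boundary G) :
    ξ ∈ arc d ↔ proj G o n (.bdry ξ) ∈ side d := by
  have key : ∀ r : Ray G, r.endpoint = ξ →
      ∀ᶠ k in atTop, (r.toFun k ∈ side d ↔ proj G o n (.bdry ξ) ∈ side d) := fun r hr => by
    filter_upwards [(proj_bdry_spec hG o n ξ).2 r hr] with k hk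
    rw [← hk, trunc_mem_side_iff hG o d h1 h2]
  constructor
  · rintro ⟨r, hr, hev⟩
    obtain ⟨k, hk1, hk2⟩ := (hev.and (key r hr)).exists
    exact hk2.1 hk1
  · intro h
    obtain ⟨r, hr⟩ := ξ.exists_ray
    exact ⟨r, hr, (key r hr).mono fun k hk => hk.2 h⟩

lemma mem_arc_symm_iff (hG : G.IsTree) (d : G.Dart) (ξ : Boundary G) :
    ξ ∈ arc d.symm ↔ ξ ∉ arc d := by
  have hd : G.dist d.fst d.snd ≤ 1 := (SimpleGraph.dist_eq_one_iff_adj.2 d.adj).le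
  have hs : G.dist d.fst d.fst ≤ 1 := by simp
  rw [mem_arc_iff hG d.fst (n := 1) d hs hd, mem_arc_iff hG d.fst (n := 1) d.symm hd hs,
    mem_side_symm_iff hG]

/-- The boundary points with a prescribed projection form the arc of the edge that ends there. -/
lemma mem_arc_iff_proj_eq (hG : G.IsTree) (o : V) (d : G.Dart)
    (hd : G.dist o d.snd = G.dist o d.fst + 1) (ξ : Boundary G) :
    ξ ∈ arc d ↔ proj G o (G.dist o d.snd) (.bdry ξ) = d.snd := by
  rw [mem_arc_iff hG o (n := G.dist o d.snd) d (by omega) le_rfl]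
  constructor
  · intro h
    by_contra hne
    exact notMem_side_of_dist_le hG o d hd _ (proj_bdry_spec hG o _ ξ).1.le hne h
  · intro h
    rw [h]
    exact snd_mem_side d

/-- Each boundary point lies in the arc of some edge issued from a given vertex. -/
lemma exists_dart_mem_arc (hG : G.IsTree) (o : V) (ξ : Boundary G) :
    ∃ d : G.Dart, d.fst = o ∧ ξ ∈ arc d := by
  have h1 := (proj_bdry_spec hG o 1 ξ).1
  refine ⟨⟨(o, _), SimpleGraph.dist_eq_one_iff_adj.1 h1⟩, rfl, ?_⟩
  rw [mem_arc_iff hG o (n := 1) _ (by simp) h1.le]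
  exact snd_mem_side (G := G) ⟨(o, _), SimpleGraph.dist_eq_one_iff_adj.1 h1⟩

/-- A boundary point is determined by its projections. -/
lemma eq_endpoint_of_proj_eq (hG : G.IsTree) (o : V) (r : Ray G)
    (η : Boundary G)
    (h : ∀ k, proj G o (k + 1) (.bdry η) = r.toFun (k + 1)) : η = r.endpoint := by
  obtain ⟨s, rfl⟩ := η.exists_ray
  obtain ⟨N, hN⟩ := s.exists_dist_eq hG o
  refine Quotient.sound ⟨N + 1, G.dist o (s.toFun N) + 1, fun k => ?_⟩
  have h1 := proj_endpoint hG o s hN (k + 1)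
  have h2 := h (G.dist o (s.toFun N) + k)
  rw [add_assoc] at h2
  rw [h2] at h1
  rw [show N + 1 + k = N + (k + 1) by omega, ← h1]
  congr 1
  omega

/-! ### Energy and functions that factor through a projection -/

lemma sqGrad_mk (F : TBar G → ℝ) (x y : V) :
    sqGrad F s(x, y) = ENNReal.ofReal ((F (.vertex x) - F (.vertex y)) ^ 2) := rfl

lemma energy_mono {F H : TBar G → ℝ}
    (h : ∀ x y, G.Adj x y → (F (.vertex x) - F (.vertex y)) ^ 2 ≤
      (H (.vertex x) - H (.vertex y)) ^ 2) : energy F ≤ energy H := by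
  refine ENNReal.tsum_le_tsum ?_
  rintro ⟨α, hα⟩
  induction α using Sym2.inductionOn with
  | hf x y => exact ENNReal.ofReal_le_ofReal (h x y hα)

lemma energy_const_mul (c : ℝ) (F : TBar G → ℝ) :
    energy (fun x => c * F x) = ENNReal.ofReal (c ^ 2) * energy F := by
  rw [energy, energy, ← ENNReal.tsum_mul_left]
  congr 1
  ext ⟨α, hα⟩
  induction α using Sym2.inductionOn with
  | hf x y =>
    simp only [sqGrad_mk]
    rw [← ENNReal.ofReal_mul (sq_nonneg c)]
    congr 1
    ring

lemma trunc_eq_or_of_adj (hG : G.IsTree) (o : V) (n : ℕ) {x y : V} (h : G.Adj x y) :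
    trunc G o n x = trunc G o n y ∨
      (G.dist o x ≤ n ∧ G.dist o y ≤ n ∧ trunc G o n x = x ∧ trunc G o n y = y) := by
  wlog hd : G.dist o x = G.dist o y + 1 generalizing x y
  · rcases this h.symm ((hG.dist_eq_dist_add_one_of_adj o h).resolve_left hd) with h | h
    · exact Or.inl h.symm
    · exact Or.inr ⟨h.2.1, h.1, h.2.2.2, h.2.2.1⟩
  by_cases hn : n ≤ G.dist o y
  · exact Or.inl (trunc_eq_of_adj hG o h hd hn)
  · exact Or.inr ⟨by omega, by omega, trunc_of_le o (by omega), trunc_of_le o (by omega)⟩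

/-- Composing with a projection removes the increments outside the ball and keeps those inside. -/
lemma energy_comp_proj_le (hG : G.IsTree) (o : V) (n : ℕ) (g : V → ℝ) (w : Sym2 V → ℝ≥0∞)
    (h : ∀ x y, G.Adj x y → ENNReal.ofReal ((g x - g y) ^ 2) ≤ w s(x, y)) :
    energy (G := G) (fun x => g (proj G o n x)) ≤ ∑' α : G.edgeSet, w α := by
  refine ENNReal.tsum_le_tsum ?_
  rintro ⟨α, hα⟩
  induction α using Sym2.inductionOn with
  | hf x y =>
    simp only [sqGrad_mk, proj_vertex]
    rcases trunc_eq_or_of_adj hG o n (show G.Adj x y from hα) with h' | ⟨-, -, h1, h2⟩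
    · simp [h']
    · rw [h1, h2]
      exact h x y hα

lemma finite_sqGrad_comp_proj [G.LocallyFinite] (hG : G.IsTree) (o : V) (n : ℕ) (g : V → ℝ) :
    {α : Sym2 V | α ∈ G.edgeSet ∧ sqGrad (G := G) (fun x => g (proj G o n x)) α ≠ 0}.Finite := by
  have hfin := finite_dist_le hG o n
  refine ((hfin.prod hfin).image fun p : V × V => s(p.1, p.2)).subset ?_
  rintro α ⟨hα, hne⟩
  induction α using Sym2.inductionOn with
  | hf x y =>
    rcases trunc_eq_or_of_adj hG o n (show G.Adj x y from hα) with h | ⟨h1, h2, -, -⟩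
    · simp [sqGrad_mk, proj_vertex, h] at hne
    · exact ⟨(x, y), ⟨h1, h2⟩, rfl⟩

lemma hasRadialLimit_comp_proj (hG : G.IsTree) (o : V) (n : ℕ) (g : V → ℝ) (ξ : Boundary G) :
    HasRadialLimit (fun x => g (proj G o n x)) ξ := by
  intro r hr
  refine tendsto_const_nhds.congr' ?_
  filter_upwards [(proj_bdry_spec hG o n ξ).2 r hr] with k hk
  rw [proj_vertex, hk]

lemma condenserCap_le_energy [G.LocallyFinite] (hG : G.IsTree) (o : V) (n : ℕ) (g : V → ℝ)
    {A B : Set (Boundary G)} (hA : ∀ ξ ∈ A, g (proj G o n (.bdry ξ)) = 1)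
    (hB : ∀ ξ ∈ B, g (proj G o n (.bdry ξ)) = 0) :
    condenserCap A B ≤ energy (G := G) (fun x => g (proj G o n x)) :=
  sInf_le ⟨_, hasRadialLimit_comp_proj hG o n g, hA, hB, finite_sqGrad_comp_proj hG o n g, rfl⟩

/-- A function with radial limits is the limit of its compositions with the projections. -/
lemma tendsto_comp_proj (hG : G.IsTree) (o : V) {F : TBar G → ℝ} {ξ : Boundary G}
    (h : HasRadialLimit F ξ) :
    Tendsto (fun n => F (.vertex (proj G o n (.bdry ξ)))) atTop (𝓝 (F (.bdry ξ))) := by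
  obtain ⟨r, rfl⟩ := ξ.exists_ray
  obtain ⟨N, hN⟩ := r.exists_dist_eq hG o
  rw [← tendsto_add_atTop_iff_nat (G.dist o (r.toFun N))]
  refine ((tendsto_add_atTop_iff_nat N).2 (h r rfl)).congr fun j => ?_
  rw [add_comm j (G.dist o _), proj_endpoint hG o r hN, add_comm]

/-! ### Arcs and projections are measurable -/

lemma isFiniteUnionOfArcs_arc (d : G.Dart) : IsFiniteUnionOfArcs (arc d) :=
  ⟨{d}, Set.finite_singleton d, by simp⟩

lemma isFiniteUnionOfArcs_proj [G.LocallyFinite] (hG : G.IsTree) (o : V) (n : ℕ) (S : Set V) :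
    IsFiniteUnionOfArcs {ξ : Boundary G | proj G o (n + 1) (.bdry ξ) ∈ S} := by
  have hfin := finite_dist_le hG o (n + 1)
  refine ⟨{d | d.snd ∈ S ∧ G.dist o d.snd = n + 1 ∧ G.dist o d.fst = n}, ?_, ?_⟩
  · refine ((hfin.prod hfin).preimage (SimpleGraph.Dart.toProd_injective.injOn)).subset ?_
    rintro d ⟨-, h1, h2⟩
    exact ⟨show G.dist o d.fst ≤ n + 1 by omega, h1.le⟩
  · ext ξ
    simp only [Set.mem_ofPred_eq, Set.mem_iUnion, exists_prop]
    have hn := (proj_bdry_spec hG o (n + 1) ξ).1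
    constructor
    · generalize hw : proj G o (n + 1) (.bdry ξ) = w at hn
      intro h
      have hne : w ≠ o := by
        rintro rfl
        rw [SimpleGraph.dist_self] at hn
        omega
      obtain ⟨y, hy, hd⟩ := exists_adj_dist_eq hG o hne
      refine ⟨⟨(y, _), hy.symm⟩, ⟨h, hn, show G.dist o y = n by omega⟩, ?_⟩
      rw [mem_arc_iff_proj_eq hG o _ hd]
      change proj G o (G.dist o w) _ = w
      rw [hn, hw]
    · rintro ⟨d, ⟨hS, h1, h2⟩, hd⟩
      rw [mem_arc_iff_proj_eq hG o d (by omega), h1] at hd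
      rwa [hd]

lemma measurableSet_image_vertex (S : Set V) :
    MeasurableSet ((TBar.vertex : V → TBar G) '' S) := by
  refine IsOpen.measurableSet ?_
  rw [← Set.biUnion_of_singleton S, Set.image_iUnion₂]
  refine isOpen_biUnion fun v _ => ?_
  rw [Set.image_singleton]
  exact TopologicalSpace.isOpen_generateFrom_of_mem (Or.inr ⟨v, rfl⟩)

lemma measurableSet_image_arc (d : G.Dart) :
    MeasurableSet ((TBar.bdry : Boundary G → TBar G) '' arc d) := by
  have : (TBar.bdry : Boundary G → TBar G) '' arc d = tent d \ (TBar.vertex '' Set.univ) := by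
    ext x
    cases x <;> simp [tent]
  rw [this]
  refine MeasurableSet.diff (IsOpen.measurableSet ?_) (measurableSet_image_vertex _)
  exact TopologicalSpace.isOpen_generateFrom_of_mem (Or.inl ⟨d, rfl⟩)

lemma IsFiniteUnionOfArcs.measurableSet_image {A : Set (Boundary G)}
    (hA : IsFiniteUnionOfArcs A) : MeasurableSet ((TBar.bdry : Boundary G → TBar G) '' A) := by
  obtain ⟨s, hs, rfl⟩ := hA
  rw [Set.image_iUnion₂]
  exact hs.measurableSet_biUnion fun d _ => measurableSet_image_arc d

lemma measurable_comp_proj [G.LocallyFinite] (hG : G.IsTree) (o : V) (n : ℕ) (g : V → ℝ) :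
    Measurable fun x : TBar G => g (proj G o (n + 1) x) := by
  intro s _
  have : (fun x : TBar G => g (proj G o (n + 1) x)) ⁻¹' s =
      TBar.vertex '' {x | trunc G o (n + 1) x ∈ g ⁻¹' s} ∪
      TBar.bdry '' {ξ | proj G o (n + 1) (.bdry ξ) ∈ g ⁻¹' s} := by
    ext x
    cases x <;> simp [proj_vertex]
  rw [this]
  exact (measurableSet_image_vertex _).union
    (isFiniteUnionOfArcs_proj hG o n _).measurableSet_image

variable {μ : Measure (TBar G)}

lemma ae_eq_bdry [G.LocallyFinite] (hG : G.IsTree) (hμ : ∀ v : V, μ {TBar.vertex v} = 0) :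
    ∀ᵐ x ∂μ, ∃ ξ, x = TBar.bdry ξ := by
  have := countable_of_isTree hG
  have h0 : μ (⋃ v : V, {TBar.vertex v}) = 0 := measure_iUnion_null hμ
  refine measure_mono_null (fun x hx => ?_) h0
  cases x with
  | vertex v => exact Set.mem_iUnion.2 ⟨v, rfl⟩
  | bdry ξ => exact absurd ⟨ξ, rfl⟩ hx

lemma Admissible.ae_tendsto [G.LocallyFinite] (hG : G.IsTree)
    (hμ : ∀ v : V, μ {TBar.vertex v} = 0) (o : V) {F : TBar G → ℝ} (hF : Admissible μ F) :
    ∀ᵐ x ∂μ, Tendsto (fun n => F (.vertex (proj G o (n + 1) x))) atTop (𝓝 (F x)) := by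
  filter_upwards [hF, ae_eq_bdry hG hμ] with x hx hb
  obtain ⟨ξ, rfl⟩ := hb
  exact (tendsto_add_atTop_iff_nat 1).2 (tendsto_comp_proj hG o (hx ξ rfl))

lemma Admissible.aemeasurable [G.LocallyFinite] (hG : G.IsTree)
    (hμ : ∀ v : V, μ {TBar.vertex v} = 0) {F : TBar G → ℝ} (hF : Admissible μ F) :
    AEMeasurable F μ := by
  obtain ⟨o⟩ := hG.connected.nonempty
  exact aemeasurable_of_tendsto_metrizable_ae atTop
    (fun n => (measurable_comp_proj hG o n fun v => F (.vertex v)).aemeasurable)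
    (hF.ae_tendsto hG hμ o)

lemma measure_arc_add_measure_arc_symm [G.LocallyFinite] [IsProbabilityMeasure μ] (hG : G.IsTree)
    (hμ : ∀ v : V, μ {TBar.vertex v} = 0) (d : G.Dart) :
    μ (TBar.bdry '' arc d) + μ (TBar.bdry '' arc d.symm) = 1 := by
  rw [← prob_add_prob_compl (μ := μ) (measurableSet_image_arc d)]
  congr 1
  refine measure_congr ?_
  filter_upwards [ae_eq_bdry hG hμ] with x hx
  obtain ⟨ξ, rfl⟩ := hx
  refine propext ?_
  change TBar.bdry ξ ∈ TBar.bdry '' arc d.symm ↔ TBar.bdry ξ ∉ TBar.bdry '' arc d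
  simp [mem_arc_symm_iff hG]

lemma disjoint_arc_symm (hG : G.IsTree) (d : G.Dart) : Disjoint (arc d) (arc d.symm) :=
  Set.disjoint_left.2 fun ξ h h' => (mem_arc_symm_iff hG d ξ).1 h' h

/-! ### The comparisons that hold for every probability measure without mass on vertices -/

/-- The energy is unchanged when the constant `F(o)` is subtracted, and the variance of `F` is at most
the second moment of `F - F(o)`. -/
lemma invHardyConst_le_hardyConst [G.LocallyFinite] [IsProbabilityMeasure μ] (hG : G.IsTree)
    (hμ : ∀ v : V, μ {TBar.vertex v} = 0) (o : V) : invHardyConst μ ≤ hardyConst μ o := by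
  refine le_sInf fun C hC => sInf_le fun F hF => ?_
  set c := F (.vertex o)
  have hadm : Admissible μ fun x => F x - c := by
    filter_upwards [hF] with x hx ξ hξ r hr
    exact (hx ξ hξ r hr).sub_const c
  have h1 := hC _ hadm
  have h2 : energy (fun x => F x - c) ≤ energy F :=
    energy_mono fun x y _ => by rw [sub_sub_sub_cancel_right]
  have h3 : ∫⁻ x, ENNReal.ofReal ((F x - c) ^ 2) ∂μ ≤ C * energy F := by
    refine h1.trans ?_
    rw [sub_self, zero_pow two_ne_zero, ENNReal.ofReal_zero, zero_add]
    gcongr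
  refine le_trans ?_ h3
  by_cases htop : ∫⁻ x, ENNReal.ofReal ((F x - c) ^ 2) ∂μ = ∞
  · rw [htop]
    exact le_top
  have hm := hF.aemeasurable hG hμ
  have hLp : MemLp (fun x => F x - c) 2 μ := by
    rw [memLp_two_iff_integrable_sq (hm.sub_const c).aestronglyMeasurable]
    refine ⟨((hm.sub_const c).pow_const 2).aestronglyMeasurable, ?_⟩
    rw [hasFiniteIntegral_iff_ofReal (ae_of_all _ fun x => sq_nonneg _)]
    exact lt_top_iff_ne_top.2 htop
  have hLpF : MemLp F 2 μ := by
    have := hLp.add (memLp_const c)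
    simpa [Pi.add_def] using this
  rw [← ProbabilityTheory.ofReal_variance hLpF,
    ← ProbabilityTheory.variance_sub_const hm.aestronglyMeasurable c]
  rw [← ofReal_integral_eq_lintegral_ofReal hLp.integrable_sq (ae_of_all _ fun x => sq_nonneg _)]
  exact ENNReal.ofReal_le_ofReal
    (ProbabilityTheory.variance_le_expectation_sq (hm.sub_const c).aestronglyMeasurable)

/-- If `F` is `1` on `A` and `0` on `B`, then the variance of `F` is at least `μ(A) μ(B)`. -/
lemma mul_measure_le_evariance [IsProbabilityMeasure μ] {A B : Set (TBar G)}
    (hA : MeasurableSet A) (hB : MeasurableSet B) (hAB : Disjoint A B) {F : TBar G → ℝ}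
    (hFA : ∀ x ∈ A, F x = 1) (hFB : ∀ x ∈ B, F x = 0) :
    μ A * μ B ≤ ProbabilityTheory.evariance F μ := by
  rw [ProbabilityTheory.evariance_eq_lintegral_ofReal]
  set m := ∫ x, F x ∂μ
  have hmem : ∀ (s : Set (TBar G)) (c : ℝ), MeasurableSet s → (∀ x ∈ s, F x = c) →
      ∫⁻ x in s, ENNReal.ofReal ((F x - m) ^ 2) ∂μ = ENNReal.ofReal (((c - m) ^ 2)) * μ s :=
    fun s c hs hc => by
      rw [setLIntegral_congr_fun hs fun x hx => by rw [hc x hx], setLIntegral_const]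
  calc μ A * μ B ≤ ENNReal.ofReal ((1 - m) ^ 2) * μ A + ENNReal.ofReal ((0 - m) ^ 2) * μ B := by
        have ha : μ.real A + μ.real B ≤ 1 := by
          rw [← measureReal_union hAB hB]
          exact measureReal_le_one
        rw [← ofReal_measureReal (μ := μ) (s := A), ← ofReal_measureReal (μ := μ) (s := B)]
        rw [← ENNReal.ofReal_mul (by positivity), ← ENNReal.ofReal_mul (by positivity),
          ← ENNReal.ofReal_mul (by positivity), ← ENNReal.ofReal_add (by positivity)
          (by positivity)]
        refine ENNReal.ofReal_le_ofReal ?_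
        have h1 : 0 ≤ μ.real A := measureReal_nonneg
        have h2 : 0 ≤ μ.real B := measureReal_nonneg
        -- the minimum over `m` of the right-hand side is `a b / (a + b)`
        generalize μ.real A = a at *
        generalize μ.real B = b at *
        nlinarith [sq_nonneg ((a + b) * m - a), mul_nonneg h1 h2, mul_nonneg h1 (sq_nonneg (1 - m)),
          mul_nonneg h2 (sq_nonneg m)]
    _ = ∫⁻ x in A ∪ B, ENNReal.ofReal ((F x - m) ^ 2) ∂μ := by
        rw [lintegral_union hB hAB, hmem A 1 hA hFA, hmem B 0 hB hFB]
    _ ≤ _ := setLIntegral_le_lintegral _ _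

lemma div_sInf_le_of_forall_le_mul {x C : ℝ≥0∞} {S : Set ℝ≥0∞} (h : ∀ c ∈ S, x ≤ C * c) :
    x / sInf S ≤ C := by
  rcases eq_or_ne C ∞ with rfl | hC
  · exact le_top
  rcases eq_or_ne (sInf S) ∞ with hS | hS
  · rw [hS, ENNReal.div_top]
    exact zero_le
  refine ENNReal.div_le_of_le_mul ?_
  rw [mul_comm, ← ENNReal.div_le_iff_le_mul (Or.inr hS) (Or.inl hC)]
  exact le_sInf fun c hc => ENNReal.div_le_of_le_mul' (h c hc)

lemma condenserSup_le_invHardyConst [IsProbabilityMeasure μ] :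
    condenserSup μ ≤ invHardyConst μ := by
  refine iSup_le fun A => iSup_le fun B => iSup_le fun hA => iSup_le fun hB => iSup_le fun hAB => ?_
  refine le_sInf fun C hC => div_sInf_le_of_forall_le_mul ?_
  rintro _ ⟨F, hF, hFA, hFB, -, rfl⟩
  refine le_trans ?_ (hC F (ae_of_all _ fun x ξ _ => hF ξ))
  refine mul_measure_le_evariance hA.measurableSet_image hB.measurableSet_image ?_ ?_ ?_
  · refine (Set.disjoint_image_iff fun a b h => ?_).2 hAB
    injection h
  · rintro _ ⟨ξ, hξ, rfl⟩
    exact hFA ξ hξ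
  · rintro _ ⟨ξ, hξ, rfl⟩
    exact hFB ξ hξ

/-! ### Dyadic truncation -/

/-- The part of `|t|` between the levels `2 ^ k` and `2 ^ (k + 1)`. -/
noncomputable def dyadicPart (k : ℤ) (t : ℝ) : ℝ := min (max (|t| - 2 ^ k) 0) (2 ^ k)

lemma dyadicPart_of_le {k : ℤ} {t : ℝ} (h : 2 ^ (k + 1) ≤ |t|) : dyadicPart k t = 2 ^ k := by
  have h2 : (0 : ℝ) < 2 ^ k := by positivity
  rw [zpow_add_one₀ two_ne_zero] at h
  rw [dyadicPart, max_eq_left (by linarith), min_eq_right (by linarith)]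

lemma dyadicPart_zero (k : ℤ) : dyadicPart k 0 = 0 := by
  have h2 : (0 : ℝ) < 2 ^ k := by positivity
  rw [dyadicPart, abs_zero, zero_sub, max_eq_right (by linarith), min_eq_left h2.le]

/-- The increment of the `k`-th dyadic part is the length of the piece of `[|b|, |a|)` between the
levels `2 ^ k` and `2 ^ (k + 1)`; these pieces are disjoint. -/
lemma tsum_ofReal_sq_dyadicPart_sub_le (a b : ℝ) :
    ∑' k : ℤ, ENNReal.ofReal ((dyadicPart k a - dyadicPart k b) ^ 2) ≤
      ENNReal.ofReal ((a - b) ^ 2) := by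
  wlog hab : |b| ≤ |a| generalizing a b
  · refine le_trans (le_of_eq ?_) ((this b a (not_le.1 hab).le).trans (le_of_eq ?_))
    · congr 1
      ext k
      congr 1
      ring
    · congr 1
      ring
  have hpw : ∀ k : ℤ, ENNReal.ofReal ((dyadicPart k a - dyadicPart k b) ^ 2) ≤
      ENNReal.ofReal (|a| - |b|) *
        volume (Set.Ico ((2 : ℝ) ^ k) (2 ^ (k + 1)) ∩ Set.Ico |b| |a|) := fun k => by
    rw [Set.Ico_inter_Ico, Real.volume_Ico, ← ENNReal.ofReal_mul (by linarith)]
    have h2 : (0 : ℝ) < 2 ^ k := by positivity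
    rw [zpow_add_one₀ two_ne_zero]
    have h0 : 0 ≤ dyadicPart k a - dyadicPart k b := by
      rw [sub_nonneg, dyadicPart, dyadicPart]
      gcongr
    have h1 : dyadicPart k a - dyadicPart k b ≤ |a| - |b| := by
      rw [dyadicPart, dyadicPart]
      grind
    rcases h0.eq_or_lt with h | h
    · simp [← h]
    refine ENNReal.ofReal_le_ofReal ?_
    have h3 : dyadicPart k a - dyadicPart k b ≤ min (2 ^ k * 2) |a| - max (2 ^ k) |b| := by
      rw [dyadicPart, dyadicPart] at h ⊢
      grind
    rw [sq]
    exact mul_le_mul h1 h3 h0 (by linarith)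
  have hmono : Monotone fun k : ℤ => (2 : ℝ) ^ k := fun i j hij => zpow_le_zpow_right₀ one_le_two hij
  calc _ ≤ ∑' k : ℤ, ENNReal.ofReal (|a| - |b|) *
        volume (Set.Ico ((2 : ℝ) ^ k) (2 ^ (k + 1)) ∩ Set.Ico |b| |a|) := ENNReal.tsum_le_tsum hpw
    _ = ENNReal.ofReal (|a| - |b|) *
        volume (⋃ k : ℤ, Set.Ico ((2 : ℝ) ^ k) (2 ^ (k + 1)) ∩ Set.Ico |b| |a|) := by
      rw [ENNReal.tsum_mul_left, measure_iUnion]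
      · exact fun i j hij => (hmono.pairwise_disjoint_on_Ico_succ hij).mono
          Set.inter_subset_left Set.inter_subset_left
      · exact fun k => measurableSet_Ico.inter measurableSet_Ico
    _ ≤ ENNReal.ofReal (|a| - |b|) * volume (Set.Ico |b| |a|) := by
      gcongr
      exact Set.iUnion_subset fun k => Set.inter_subset_right
    _ ≤ ENNReal.ofReal ((a - b) ^ 2) := by
      rw [Real.volume_Ico, ← ENNReal.ofReal_mul (by linarith)]
      refine ENNReal.ofReal_le_ofReal ?_
      rw [← sq, ← sq_abs (a - b)]
      exact pow_le_pow_left₀ (by linarith) (abs_sub_abs_le_abs_sub a b) 2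

lemma ofReal_sq_le_tsum (t : ℝ) :
    ENNReal.ofReal (t ^ 2) ≤ 16 * ∑' k : ℤ,
      Set.indicator {s : ℝ | 2 ^ (k + 1) ≤ |s|} (fun _ => ENNReal.ofReal (4 ^ k)) t := by
  rcases eq_or_ne t 0 with rfl | ht
  · simp
  -- the term of index `m - 1` dominates when `2 ^ m ≤ |t| < 2 ^ (m + 1)`
  obtain ⟨m, hm1, hm2⟩ := exists_mem_Ico_zpow (abs_pos.2 ht) (one_lt_two (α := ℝ))
  refine le_trans ?_ (mul_le_mul_right (ENNReal.le_tsum (m - 1)) 16)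
  rw [Set.indicator_of_mem (by simpa using hm1), ← sq_abs]
  rw [show (16 : ℝ≥0∞) = ENNReal.ofReal 16 by simp, ← ENNReal.ofReal_mul (by norm_num)]
  refine ENNReal.ofReal_le_ofReal ?_
  have h4 : (4 : ℝ) ^ (m - 1) = (2 ^ (m - 1)) ^ 2 := by
    rw [← zpow_natCast, ← zpow_mul, mul_comm, zpow_mul]
    norm_num
  have h2 : (2 : ℝ) ^ (m + 1) = 4 * 2 ^ (m - 1) := by
    rw [show m + 1 = (m - 1) + 2 by ring, zpow_add₀ two_ne_zero]
    norm_num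
    ring
  rw [h2] at hm2
  rw [h4]
  calc |t| ^ 2 ≤ (4 * 2 ^ (m - 1)) ^ 2 := pow_le_pow_left₀ (abs_nonneg t) hm2.le 2
    _ = 16 * (2 ^ (m - 1)) ^ 2 := by ring

lemma tsum_energy_dyadicPart_le (F : TBar G → ℝ) :
    ∑' k : ℤ, energy (fun x => dyadicPart k (F x)) ≤ energy F := by
  simp only [energy]
  rw [ENNReal.tsum_comm]
  refine ENNReal.tsum_le_tsum ?_
  rintro ⟨α, hα⟩
  induction α using Sym2.inductionOn with
  | hf x y => exact tsum_ofReal_sq_dyadicPart_sub_le _ _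

/-! ### The capacitary inequality -/

lemma mul_measure_le_condenserSup_mul_cap {A B : Set (Boundary G)} (hA : IsFiniteUnionOfArcs A)
    (hB : IsFiniteUnionOfArcs B) (hAB : Disjoint A B) (h0 : condenserSup μ ≠ 0)
    (hS : condenserSup μ ≠ ∞) :
    μ (TBar.bdry '' A) * μ (TBar.bdry '' B) ≤ condenserSup μ * condenserCap A B := by
  rw [← ENNReal.div_le_iff_le_mul (Or.inr hS) (Or.inr h0)]
  exact le_iSup_of_le A (le_iSup_of_le B (le_iSup_of_le hA (le_iSup_of_le hB
    (le_iSup_of_le hAB le_rfl))))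

/-- The superlevel sets of `g` at the levels `2 ^ (k + 1)` are compared with the condensers they
form with `B`, which carries half of the mass; the energies of the dyadic parts of `g` add up to
at most the energy of `g`. -/
lemma lintegral_sq_le_condenserSup_mul_energy [G.LocallyFinite] [IsProbabilityMeasure μ]
    (hG : G.IsTree) (hμ : ∀ v : V, μ {TBar.vertex v} = 0) (h0 : condenserSup μ ≠ 0)
    (hS : condenserSup μ ≠ ∞) (o : V) (n : ℕ) {B : Set (Boundary G)} (hB : IsFiniteUnionOfArcs B)
    (hμB : 1 ≤ 2 * μ (TBar.bdry '' B)) (g : V → ℝ)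
    (hg : ∀ ξ ∈ B, g (proj G o (n + 1) (.bdry ξ)) = 0) :
    ∫⁻ x, ENNReal.ofReal (g (proj G o (n + 1) x) ^ 2) ∂μ ≤
      32 * (condenserSup μ * energy (G := G) fun x => g (proj G o (n + 1) x)) := by
  set S := condenserSup μ
  have hm := measurable_comp_proj (G := G) hG o n g
  have hset : ∀ k : ℤ, MeasurableSet {s : ℝ | (2 : ℝ) ^ (k + 1) ≤ |s|} := fun k =>
    measurableSet_le measurable_const measurable_id.abs
  have key : ∀ k : ℤ, ENNReal.ofReal (4 ^ k) *
      μ {x | (2 : ℝ) ^ (k + 1) ≤ |g (proj G o (n + 1) x)|} ≤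
      2 * (S * energy (G := G) fun x => dyadicPart k (g (proj G o (n + 1) x))) := fun k => by
    set A : Set (Boundary G) := {ξ | (2 : ℝ) ^ (k + 1) ≤ |g (proj G o (n + 1) (.bdry ξ))|}
    have hA : IsFiniteUnionOfArcs A :=
      isFiniteUnionOfArcs_proj hG o n {v | (2 : ℝ) ^ (k + 1) ≤ |g v|}
    have hk2 : (2 : ℝ) ^ k ≠ 0 := by positivity
    have hAB : Disjoint A B := Set.disjoint_left.2 fun ξ h h' => by
      have h1 : (2 : ℝ) ^ (k + 1) ≤ |g (proj G o (n + 1) (.bdry ξ))| := h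
      rw [hg ξ h', abs_zero] at h1
      have : (0 : ℝ) < 2 ^ (k + 1) := by positivity
      linarith
    have hcap : condenserCap A B ≤ ENNReal.ofReal (((2 : ℝ) ^ k)⁻¹ ^ 2) *
        energy (G := G) fun x => dyadicPart k (g (proj G o (n + 1) x)) := by
      rw [← energy_const_mul]
      refine condenserCap_le_energy hG o (n + 1) (fun v => ((2 : ℝ) ^ k)⁻¹ * dyadicPart k (g v))
        (fun ξ hξ => ?_) fun ξ hξ => ?_
      · rw [dyadicPart_of_le hξ, inv_mul_cancel₀ hk2]
      · rw [hg ξ hξ, dyadicPart_zero, mul_zero]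
    have h4 : ENNReal.ofReal (4 ^ k) * ENNReal.ofReal (((2 : ℝ) ^ k)⁻¹ ^ 2) = 1 := by
      rw [← ENNReal.ofReal_mul (by positivity), ← ENNReal.ofReal_one]
      congr 1
      have : (4 : ℝ) ^ k = (2 ^ k) ^ 2 := by
        rw [← zpow_natCast, ← zpow_mul, mul_comm, zpow_mul]
        norm_num
      rw [this]
      field_simp
    have hle : μ {x | (2 : ℝ) ^ (k + 1) ≤ |g (proj G o (n + 1) x)|} ≤ μ (TBar.bdry '' A) := by
      refine measure_mono_ae ?_
      filter_upwards [ae_eq_bdry hG hμ] with x hx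
      obtain ⟨ξ, rfl⟩ := hx
      exact fun h => ⟨ξ, h, rfl⟩
    calc _ ≤ ENNReal.ofReal (4 ^ k) * (μ (TBar.bdry '' A) * (2 * μ (TBar.bdry '' B))) := by
          gcongr
          exact hle.trans (le_mul_of_one_le_right' hμB)
      _ = 2 * ENNReal.ofReal (4 ^ k) * (μ (TBar.bdry '' A) * μ (TBar.bdry '' B)) := by ring
      _ ≤ 2 * ENNReal.ofReal (4 ^ k) * (S * (ENNReal.ofReal (((2 : ℝ) ^ k)⁻¹ ^ 2) *
          energy (G := G) fun x => dyadicPart k (g (proj G o (n + 1) x)))) := by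
          refine mul_le_mul_right ?_ _
          exact (mul_measure_le_condenserSup_mul_cap hA hB hAB h0 hS).trans
            (mul_le_mul_right hcap _)
      _ = (ENNReal.ofReal (4 ^ k) * ENNReal.ofReal (((2 : ℝ) ^ k)⁻¹ ^ 2)) * (2 * (S *
          energy (G := G) fun x => dyadicPart k (g (proj G o (n + 1) x)))) := by ring
      _ = _ := by rw [h4, one_mul]
  calc _ ≤ ∫⁻ x, 16 * ∑' k : ℤ, Set.indicator {s : ℝ | 2 ^ (k + 1) ≤ |s|}
        (fun _ => ENNReal.ofReal (4 ^ k)) (g (proj G o (n + 1) x)) ∂μ :=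
        lintegral_mono fun x => ofReal_sq_le_tsum _
    _ = 16 * ∑' k : ℤ, ENNReal.ofReal (4 ^ k) *
        μ {x | (2 : ℝ) ^ (k + 1) ≤ |g (proj G o (n + 1) x)|} := by
        have hm' : ∀ k : ℤ, Measurable fun x => Set.indicator {s : ℝ | 2 ^ (k + 1) ≤ |s|}
            (fun _ => ENNReal.ofReal (4 ^ k)) (g (proj G o (n + 1) x)) := fun k =>
          (measurable_const.indicator (hset k)).comp hm
        rw [lintegral_const_mul _ (Measurable.tsum hm'),
          lintegral_tsum fun k => (hm' k).aemeasurable]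
        congr 2
        ext k
        exact lintegral_indicator_const (hm (hset k)) _
    _ ≤ 16 * ∑' k : ℤ, 2 * (S * energy (G := G) fun x =>
        dyadicPart k (g (proj G o (n + 1) x))) := by
        exact mul_le_mul_right (ENNReal.tsum_le_tsum key) 16
    _ ≤ 16 * (2 * (S * energy (G := G) fun x => g (proj G o (n + 1) x))) := by
        rw [ENNReal.tsum_mul_left, ENNReal.tsum_mul_left]
        gcongr
        exact tsum_energy_dyadicPart_le fun x => g (proj G o (n + 1) x)
    _ = _ := by ring

/-! ### Condensers formed by the edges of a path -/

/-- The sum of the indicators of the far sides of finitely many edges changes by one across each of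
these edges and is constant along all others. -/
lemma energy_sum_indicator_side_le (hG : G.IsTree) (o : V) (n : ℕ) (s : Finset ℕ) (d : ℕ → G.Dart)
    (hd : Set.InjOn (fun i => (d i).edge) s) (c : ℝ) :
    energy (G := G) (fun x => c * ∑ i ∈ s, Set.indicator (side (d i)) 1 (proj G o n x)) ≤
      ENNReal.ofReal (c ^ 2) * s.card := by
  classical
  refine (energy_comp_proj_le hG o n (fun v => c * ∑ i ∈ s, Set.indicator (side (d i)) 1 v)
    (fun α => ∑ i ∈ s, if α = (d i).edge then ENNReal.ofReal (c ^ 2) else 0) ?_).trans ?_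
  · intro x y hxy
    have hsame : ∀ i, s(x, y) ≠ (d i).edge →
        Set.indicator (side (d i)) (1 : V → ℝ) x = Set.indicator (side (d i)) 1 y := fun i hi => by
      simp only [Set.indicator_apply, mem_side_iff_of_adj hG (d i) hxy hi, Pi.one_apply]
    by_cases hex : ∃ i ∈ s, s(x, y) = (d i).edge
    · obtain ⟨i, hi, hie⟩ := hex
      refine le_trans ?_ (Finset.single_le_sum (fun _ _ => zero_le) hi)
      rw [if_pos hie, ← mul_sub, ← Finset.sum_sub_distrib, Finset.sum_eq_single i]
      · refine ENNReal.ofReal_le_ofReal ?_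
        rw [mul_pow]
        refine mul_le_of_le_one_right (sq_nonneg c) ?_
        simp only [Set.indicator_apply, Pi.one_apply]
        split_ifs <;> norm_num
      · intro j hj hji
        rw [hsame j fun he => hji (hd hj hi (he.symm.trans hie)), sub_self]
      · exact fun h => absurd hi h
    · push Not at hex
      rw [Finset.sum_congr rfl fun i hi => hsame i (hex i hi), sub_self]
      simp
  · rw [Summable.tsum_finsetSum fun i _ => ENNReal.summable]
    refine (Finset.sum_le_card_nsmul s _ (ENNReal.ofReal (c ^ 2)) fun i _ => ?_).trans ?_
    · rw [tsum_eq_single ⟨(d i).edge, (d i).edge_mem⟩ fun α hα =>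
        if_neg fun he => hα (Subtype.ext he)]
      simp
    · rw [nsmul_eq_mul, mul_comm]

lemma condenserCap_arc_symm_le_one [G.LocallyFinite] (hG : G.IsTree) (d : G.Dart) :
    condenserCap (arc d) (arc d.symm) ≤ 1 := by
  have h := energy_sum_indicator_side_le hG d.fst 1 {0} (fun _ => d) (by simp) 1
  have hd : G.dist d.fst d.snd ≤ 1 := (SimpleGraph.dist_eq_one_iff_adj.2 d.adj).le
  have hs : G.dist d.fst d.fst ≤ 1 := by simp
  refine (condenserCap_le_energy hG d.fst 1
    (fun v => 1 * ∑ i ∈ ({0} : Finset ℕ), Set.indicator (side d) 1 v) ?_ ?_).trans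
    (h.trans (by simp))
  · intro ξ hξ
    rw [mem_arc_iff hG d.fst (n := 1) d hs hd] at hξ
    simp [hξ]
  · intro ξ hξ
    rw [mem_arc_symm_iff hG, mem_arc_iff hG d.fst (n := 1) d hs hd] at hξ
    simp [hξ]

section Chain

variable {d : ℕ → G.Dart} {o : V}

lemma mem_side_of_lt (hG : G.IsTree) (hd : ∀ k, (d k).snd = (d (k + 1)).fst)
    (ho : ∀ k, G.dist o (d k).fst = k) (k j : ℕ) : (d (k + 1 + j)).fst ∈ side (d k) := by
  induction j with
  | zero =>
    rw [add_zero, ← hd]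
    exact snd_mem_side _
  | succ j ih =>
    have hadj := (d (k + 1 + j)).adj
    rw [hd] at hadj
    refine (mem_side_iff_of_adj hG (d k) hadj fun he => ?_).1 ih
    have : (d (k + 1 + j + 1)).fst ∈ s((d k).fst, (d k).snd) := by
      rw [show s((d k).fst, (d k).snd) = (d k).edge from rfl, ← he]
      exact Sym2.mem_mk_right _ _
    have h1 := ho (k + 1 + j + 1)
    rcases Sym2.mem_iff.1 this with h | h
    · rw [h, ho] at h1
      omega
    · rw [h, hd, ho] at h1
      omega

lemma side_succ_subset (hG : G.IsTree) (hd : ∀ k, (d k).snd = (d (k + 1)).fst)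
    (ho : ∀ k, G.dist o (d k).fst = k) (k : ℕ) : side (d (k + 1)) ⊆ side (d k) := by
  intro x
  have hdist : ∀ j, G.dist o (d j).snd = j + 1 := fun j => by rw [hd, ho]
  induction x using trunc_induction hG o 0 with
  | base x hx =>
    have h := notMem_side_of_dist_le hG o (d (k + 1)) (by rw [hdist, ho]) x
      (by rw [hdist]; omega) (fun he => by rw [he, hdist] at hx; omega)
    exact fun h' => absurd h' h
  | step x y hxy hdx _ ih =>
    intro hx
    by_contra hxk
    by_cases hy : y ∈ side (d (k + 1))
    · have he := edge_eq_of_mem_side hG (d k) hxy.symm (ih hy) hxk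
      rcases Sym2.eq_iff.1 he with ⟨h1, h2⟩ | ⟨h1, h2⟩
      · exact fst_notMem_side (d k) (h1 ▸ ih hy)
      · have h3 : G.dist o y = k + 1 := by rw [h1]; exact hdist k
        have h4 : G.dist o x = k := by rw [h2]; exact ho k
        omega
    · have he := edge_eq_of_mem_side hG (d (k + 1)) hxy hx hy
      rcases Sym2.eq_iff.1 he with ⟨h1, h2⟩ | ⟨h1, h2⟩
      · have h3 : G.dist o x = k + 1 := by rw [h1]; exact ho (k + 1)
        have h4 : G.dist o y = k + 2 := by rw [h2]; exact hdist (k + 1)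
        omega
      · refine hxk ?_
        rw [h1]
        rw [hd]
        exact mem_side_of_lt hG hd ho k 1

lemma side_add_subset (hG : G.IsTree) (hd : ∀ k, (d k).snd = (d (k + 1)).fst)
    (ho : ∀ k, G.dist o (d k).fst = k) (i j : ℕ) : side (d (i + j)) ⊆ side (d i) := by
  induction j with
  | zero => exact subset_rfl
  | succ j ih => exact (side_succ_subset hG hd ho (i + j)).trans ih

/-- The condenser formed by the two ends of a path of `n + 1` edges; the function that grows
by `1 / (n + 1)` across each of them has energy `1 / (n + 1)`. -/
lemma condenserCap_chain_le [G.LocallyFinite] (hG : G.IsTree)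
    (hd : ∀ k, (d k).snd = (d (k + 1)).fst) (ho : ∀ k, G.dist o (d k).fst = k) (m n : ℕ) :
    condenserCap (arc (d (m + n))) (arc (d m).symm) ≤ ((n + 1 : ℕ) : ℝ≥0∞)⁻¹ := by
  have hdist : ∀ j, G.dist o (d j).snd = j + 1 := fun j => by rw [hd, ho]
  -- heads and tails are told apart by their distance from `o`, so the edges are distinct
  have hinj : Set.InjOn (fun i => (d i).edge) (Finset.Icc m (m + n) : Finset ℕ) := by
    intro i _ j _ hij
    have hij' : s((d i).fst, (d i).snd) = s((d j).fst, (d j).snd) := hij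
    rcases Sym2.eq_iff.1 hij' with ⟨h1, -⟩ | ⟨h1, h2⟩
    · simpa [ho] using congrArg (G.dist o) h1
    · have h3 := congrArg (G.dist o) h1
      have h4 := congrArg (G.dist o) h2
      rw [hdist, ho] at h3 h4
      omega
  have hn : ((n + 1 : ℕ) : ℝ) ≠ 0 := by positivity
  set c : ℝ := ((n + 1 : ℕ) : ℝ)⁻¹ with hc
  have hcard : (Finset.Icc m (m + n)).card = n + 1 := by
    rw [Nat.card_Icc]
    omega
  have h := energy_sum_indicator_side_le hG o (m + n + 1) (Finset.Icc m (m + n)) d hinj c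
  refine (condenserCap_le_energy hG o (m + n + 1)
    (fun v => c * ∑ i ∈ Finset.Icc m (m + n), Set.indicator (side (d i)) 1 v) ?_ ?_).trans
    (h.trans (le_of_eq ?_))
  · intro ξ hξ
    rw [mem_arc_iff hG o (n := m + n + 1) _ (by rw [ho]; omega) (by rw [hdist])] at hξ
    rw [Finset.sum_congr rfl fun i hi => Set.indicator_of_mem ?_ 1]
    · simp only [Pi.one_apply, Finset.sum_const, hcard, nsmul_eq_mul, mul_one]
      exact inv_mul_cancel₀ hn
    · obtain ⟨j, hj⟩ := Nat.exists_eq_add_of_le (Finset.mem_Icc.1 hi).2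
      rw [hj] at hξ ⊢
      exact side_add_subset hG hd ho i j hξ
  · intro ξ hξ
    rw [mem_arc_symm_iff hG,
      mem_arc_iff hG o (n := m + n + 1) _ (by rw [ho]; omega) (by rw [hdist]; omega)] at hξ
    rw [Finset.sum_eq_zero fun i hi => Set.indicator_of_notMem ?_ 1, mul_zero]
    obtain ⟨j, rfl⟩ := Nat.exists_eq_add_of_le (Finset.mem_Icc.1 hi).1
    exact fun h' => hξ (side_add_subset hG hd ho m j h')
  · have hc0 : (0 : ℝ) < ((n + 1 : ℕ) : ℝ) := by positivity
    rw [hcard, hc, ← ENNReal.ofReal_natCast, ← ENNReal.ofReal_mul (by positivity),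
      ← ENNReal.ofReal_inv_of_pos hc0]
    congr 1
    field_simp

end Chain

/-! ### Existence of a median vertex -/

lemma eq_dirac_of_ae_eq [IsProbabilityMeasure μ] {a : TBar G} (h : ∀ᵐ x ∂μ, x = a) :
    μ = Measure.dirac a := by
  refine Measure.ext fun s hs => ?_
  rw [Measure.dirac_apply' a hs]
  by_cases ha : a ∈ s
  · rw [Set.indicator_of_mem ha, Pi.one_apply, ← prob_compl_eq_zero_iff hs]
    exact measure_mono_null (fun x hx (he : x = a) => hx (he ▸ ha)) h
  · rw [Set.indicator_of_notMem ha]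
    exact measure_mono_null (fun x hx (he : x = a) => ha (he ▸ hx)) h

/-- Without a median vertex, following the edges whose arcs carry more than half of the mass leads
to a boundary point of mass at least one half. Arcs shrinking to that point form condensers of
arbitrarily small capacity with a fixed arc of positive mass, unless `μ` is a Dirac mass. -/
lemma condenserSup_eq_top_of_forall_exists [G.LocallyFinite] [IsProbabilityMeasure μ]
    (hG : G.IsTree) (hμ : ∀ v : V, μ {TBar.vertex v} = 0)
    (hdirac : ∀ ξ : Boundary G, μ ≠ Measure.dirac (TBar.bdry ξ))
    (h : ∀ o : V, ∃ d : G.Dart, d.fst = o ∧ 1 < 2 * μ (TBar.bdry '' arc d)) :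
    condenserSup μ = ∞ := by
  choose nx hfst hnx using h
  obtain ⟨o⟩ := hG.connected.nonempty
  let r : ℕ → V := fun k => (fun v => (nx v).snd)^[k] o
  have hr : ∀ k, r (k + 1) = (nx (r k)).snd := fun k => Function.iterate_succ_apply' _ _ _
  let d : ℕ → G.Dart := fun k => nx (r k)
  have hdfst : ∀ k, (d k).fst = r k := fun k => hfst _
  have hd : ∀ k, (d k).snd = (d (k + 1)).fst := fun k => by rw [hdfst, hr]
  have hadj : ∀ k, G.Adj (r k) (r (k + 1)) := fun k => by
    have h := (d k).adj
    rwa [hd, hdfst, hdfst] at h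
  -- backtracking would give two complementary arcs each of mass more than one half
  have hne : ∀ k, r (k + 2) ≠ r k := fun k he => by
    have hsymm : d (k + 1) = (d k).symm := by
      refine SimpleGraph.Dart.ext _ _ (Prod.ext ?_ ?_)
      · exact (hd k).symm
      · exact (hr (k + 1)).symm.trans (he.trans (hdfst k).symm)
    have h1 := measure_arc_add_measure_arc_symm hG hμ (d k)
    have h2 : 1 < 2 * μ (TBar.bdry '' arc (d k)) := hnx (r k)
    have h3 : 1 < 2 * μ (TBar.bdry '' arc (d k).symm) := hsymm ▸ hnx (r (k + 1))
    have h4 := ENNReal.add_lt_add h2 h3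
    rw [← mul_add, h1] at h4
    norm_num at h4
  have hdist : ∀ k, G.dist o (r k) = k := fun k => by
    have h0 : G.dist o (r 0) = 0 := SimpleGraph.dist_self
    have h1 : G.dist o (r 1) = 1 := SimpleGraph.dist_eq_one_iff_adj.2 (hadj 0)
    have := dist_eq_add_of_ne hG o r hadj hne (N := 0) (by rw [h0]; exact h1) k
    rwa [h0, zero_add] at this
  have ho : ∀ k, G.dist o (d k).fst = k := fun k => by rw [hdfst, hdist]
  let ρ : Ray G := ⟨r, hadj, fun i j hij => by
    rw [← hdist i, ← hdist j, hij]⟩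
  -- if every complementary arc were null, `μ` would be concentrated at the endpoint of the ray
  obtain ⟨m, hm⟩ : ∃ m, μ (TBar.bdry '' arc (d m).symm) ≠ 0 := by
    by_contra! hcon
    refine hdirac ρ.endpoint (eq_dirac_of_ae_eq ?_)
    filter_upwards [ae_eq_bdry hG hμ, ae_all_iff.2 fun m => measure_eq_zero_iff_ae_notMem.1 (hcon m)]
      with x hx hxm
    obtain ⟨ξ, rfl⟩ := hx
    refine congrArg _ (eq_endpoint_of_proj_eq hG o ρ ξ fun k => ?_)
    have hk : ξ ∈ arc (d k) := by
      by_contra hk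
      exact hxm k ⟨ξ, (mem_arc_symm_iff hG _ _).2 hk, rfl⟩
    have hs : (d k).snd = r (k + 1) := (hr k).symm
    rw [mem_arc_iff_proj_eq hG o (d k) (by rw [hd, ho, ho]), hs, hdist] at hk
    exact hk
  by_contra hS
  obtain ⟨n, hn⟩ := ENNReal.exists_nat_mul_gt hm (ENNReal.mul_ne_top ENNReal.ofNat_ne_top hS :
    2 * condenserSup μ ≠ ∞)
  set b := μ (TBar.bdry '' arc (d m).symm)
  refine absurd hn (not_lt.2 ?_)
  have hdisj : Disjoint (arc (d (m + n))) (arc (d m).symm) := by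
    refine Set.disjoint_left.2 fun ξ h1 h2 => (mem_arc_symm_iff hG _ _).1 h2 ?_
    obtain ⟨s, hs, hev⟩ := h1
    exact ⟨s, hs, hev.mono fun k hk => side_add_subset hG hd ho m n hk⟩
  calc (n : ℝ≥0∞) * b ≤ ((n + 1 : ℕ) : ℝ≥0∞) * b := by
        gcongr
        omega
    _ ≤ ((n + 1 : ℕ) : ℝ≥0∞) * (2 * μ (TBar.bdry '' arc (d (m + n))) * b) := by
        gcongr
        exact le_mul_of_one_le_left' (hnx (r (m + n))).le
    _ = 2 * (μ (TBar.bdry '' arc (d (m + n))) * b / ((n + 1 : ℕ) : ℝ≥0∞)⁻¹) := by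
        rw [div_eq_mul_inv, inv_inv]
        ring
    _ ≤ 2 * (μ (TBar.bdry '' arc (d (m + n))) * b /
        condenserCap (arc (d (m + n))) (arc (d m).symm)) := by
        gcongr
        exact condenserCap_chain_le hG hd ho m n
    _ ≤ 2 * condenserSup μ := by
        gcongr
        exact le_iSup_of_le _ (le_iSup_of_le _ (le_iSup_of_le (isFiniteUnionOfArcs_arc _)
          (le_iSup_of_le (isFiniteUnionOfArcs_arc _) (le_iSup_of_le hdisj le_rfl))))

/-! ### The Hardy inequality rooted at a median vertex -/

/-- At a median vertex, one of the three arcs has mass between `1 / 3` and `1 / 2`; its edge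
gives a condenser of capacity at most `1`. -/
lemma one_le_condenserSup_of_median [G.LocallyFinite] [IsProbabilityMeasure μ] (hG : G.IsTree)
    (hreg : G.IsRegularOfDegree 3) (hμ : ∀ v : V, μ {TBar.vertex v} = 0) (o : V)
    (ho : ∀ d : G.Dart, d.fst = o → 1 ≤ 2 * μ (TBar.bdry '' arc d.symm)) :
    1 ≤ 6 * condenserSup μ := by
  have hcard : Fintype.card (G.neighborSet o) = 3 := by
    rw [SimpleGraph.card_neighborSet_eq_degree]
    exact hreg o
  let D : G.neighborSet o → G.Dart := G.dartOfNeighborSet o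
  have hsum : 1 ≤ ∑ y, μ (TBar.bdry '' arc (D y)) := by
    rw [← measure_univ (μ := μ), ← tsum_fintype (L := .unconditional _)]
    refine le_trans (measure_mono_ae ?_) (measure_iUnion_le _)
    filter_upwards [ae_eq_bdry hG hμ] with x hx _
    obtain ⟨ξ, rfl⟩ := hx
    obtain ⟨d, rfl, hd⟩ := exists_dart_mem_arc hG o ξ
    exact Set.mem_iUnion.2 ⟨⟨d.snd, d.adj⟩, ξ, hd, rfl⟩
  have : Nonempty (G.neighborSet o) := Fintype.card_pos_iff.1 (by omega)
  obtain ⟨y, -, hy⟩ := Finset.exists_max_image Finset.univ (fun y => μ (TBar.bdry '' arc (D y)))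
    Finset.univ_nonempty
  have hy3 : 1 ≤ 3 * μ (TBar.bdry '' arc (D y)) := by
    have := hsum.trans (Finset.sum_le_card_nsmul Finset.univ _ _ fun z hz => hy z hz)
    rwa [Finset.card_univ, hcard, nsmul_eq_mul] at this
  set a := μ (TBar.bdry '' arc (D y))
  set b := μ (TBar.bdry '' arc (D y).symm)
  calc (1 : ℝ≥0∞) = 1 * 1 := (one_mul 1).symm
    _ ≤ (3 * a) * (2 * b) := by
      gcongr
      exact ho (D y) rfl
    _ = 6 * (a * b / 1) := by
      rw [div_one]
      ring
    _ ≤ 6 * (a * b / condenserCap (arc (D y)) (arc (D y).symm)) := by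
      gcongr
      exact condenserCap_arc_symm_le_one hG _
    _ ≤ 6 * condenserSup μ := by
      gcongr
      exact le_iSup_of_le _ (le_iSup_of_le _ (le_iSup_of_le (isFiniteUnionOfArcs_arc _)
        (le_iSup_of_le (isFiniteUnionOfArcs_arc _)
          (le_iSup_of_le (disjoint_arc_symm hG _) le_rfl))))

/-- `F - F(o)` is cut into its restrictions to the three branches at the median vertex `o`. Each of
them vanishes on an arc carrying half of the mass, and has at most the energy of `F` because
`F - F(o)` vanishes at `o`. -/
lemma lintegral_sq_sub_le_of_median [G.LocallyFinite] [IsProbabilityMeasure μ] (hG : G.IsTree)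
    (hreg : G.IsRegularOfDegree 3) (hμ : ∀ v : V, μ {TBar.vertex v} = 0) (o : V)
    (ho : ∀ d : G.Dart, d.fst = o → 1 ≤ 2 * μ (TBar.bdry '' arc d.symm))
    (h0 : condenserSup μ ≠ 0) (hS : condenserSup μ ≠ ∞) (F : TBar G → ℝ) (n : ℕ) :
    ∫⁻ x, ENNReal.ofReal ((F (.vertex (proj G o (n + 1) x)) - F (.vertex o)) ^ 2) ∂μ ≤
      96 * (condenserSup μ * energy F) := by
  set c := F (.vertex o)
  have hcard : Fintype.card (G.neighborSet o) = 3 := by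
    rw [SimpleGraph.card_neighborSet_eq_degree]
    exact hreg o
  let D : G.neighborSet o → G.Dart := G.dartOfNeighborSet o
  let g : G.neighborSet o → V → ℝ := fun y =>
    Set.indicator (side (D y)) fun v => F (.vertex v) - c
  have hpt : ∀ v : V, ENNReal.ofReal ((F (.vertex v) - c) ^ 2) ≤
      ∑ y, ENNReal.ofReal (g y v ^ 2) := fun v => by
    by_cases hv : v = o
    · simp [hv, c]
    obtain ⟨d, rfl, hd⟩ := exists_dart_mem_side hG hv
    refine le_trans (le_of_eq ?_) (Finset.single_le_sum (fun _ _ => zero_le)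
      (Finset.mem_univ (⟨d.snd, d.adj⟩ : G.neighborSet d.fst)))
    have hd' : v ∈ side (D ⟨d.snd, d.adj⟩) := hd
    simp only [g, Set.indicator_of_mem hd']
  have henergy : ∀ y, energy (G := G) (fun x => g y (proj G o (n + 1) x)) ≤ energy F := fun y => by
    refine energy_comp_proj_le hG o (n + 1) (g y) (sqGrad F) fun x z hxz => ?_
    rw [sqGrad_mk]
    refine ENNReal.ofReal_le_ofReal ?_
    by_cases he : s(x, z) = (D y).edge
    · have ho' : o ∉ side (D y) := fst_notMem_side (D y)
      have hy' : (y : V) ∈ side (D y) := snd_mem_side (D y)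
      rcases Sym2.eq_iff.1 (show s(x, z) = s(o, (y : V)) from he) with ⟨rfl, rfl⟩ | ⟨rfl, rfl⟩
      · simp only [g, Set.indicator_of_mem hy', Set.indicator_of_notMem ho']
        exact le_of_eq (by simp only [c]; ring)
      · simp only [g, Set.indicator_of_mem hy', Set.indicator_of_notMem ho']
        exact le_of_eq (by simp only [c]; ring)
    · have hiff := mem_side_iff_of_adj hG (D y) hxz he
      by_cases hx : x ∈ side (D y)
      · simp only [g, Set.indicator_of_mem hx, Set.indicator_of_mem (hiff.1 hx)]
        exact le_of_eq (by ring)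
      · simp only [g, Set.indicator_of_notMem hx, Set.indicator_of_notMem (fun h => hx (hiff.2 h))]
        simpa using sq_nonneg _
  calc _ ≤ ∫⁻ x, ∑ y, ENNReal.ofReal (g y (proj G o (n + 1) x) ^ 2) ∂μ :=
        lintegral_mono fun x => hpt _
    _ = ∑ y, ∫⁻ x, ENNReal.ofReal (g y (proj G o (n + 1) x) ^ 2) ∂μ :=
        lintegral_finsetSum _ fun y _ =>
          ((measurable_comp_proj hG o n (g y)).pow_const 2).ennreal_ofReal
    _ ≤ (Finset.univ : Finset (G.neighborSet o)).card • (32 * (condenserSup μ * energy F)) := by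
        refine Finset.sum_le_card_nsmul _ _ _ fun y _ => ?_
        refine (lintegral_sq_le_condenserSup_mul_energy hG hμ h0 hS o n
          (isFiniteUnionOfArcs_arc (D y).symm) (ho (D y) rfl) (g y) fun ξ hξ => ?_).trans ?_
        · refine Set.indicator_of_notMem (fun h => (mem_arc_symm_iff hG _ _).1 hξ ?_) _
          rw [mem_arc_iff hG o (n := n + 1)]
          · exact h
          · change G.dist o o ≤ n + 1
            simp
          · change G.dist o y ≤ n + 1
            rw [SimpleGraph.dist_eq_one_iff_adj.2 y.2]
            omega
        · gcongr
          exact henergy y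
    _ = _ := by
        rw [Finset.card_univ, hcard, nsmul_eq_mul, ← mul_assoc]
        norm_num

/-- Fatou's lemma passes from the projected functions to `F`. The term `|F(o)|²` is harmless because
the condenser supremum is bounded below at a median vertex. -/
lemma hardyConst_le_of_median [G.LocallyFinite] [IsProbabilityMeasure μ] (hG : G.IsTree)
    (hreg : G.IsRegularOfDegree 3) (hμ : ∀ v : V, μ {TBar.vertex v} = 0) (o : V)
    (ho : ∀ d : G.Dart, d.fst = o → 1 ≤ 2 * μ (TBar.bdry '' arc d.symm))
    (hS : condenserSup μ ≠ ∞) : hardyConst μ o ≤ 192 * condenserSup μ := by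
  have h6 := one_le_condenserSup_of_median hG hreg hμ o ho
  have h0 : condenserSup μ ≠ 0 := fun h => by simp [h] at h6
  refine sInf_le fun F hF => ?_
  set c := F (.vertex o)
  have hfatou : ∫⁻ x, ENNReal.ofReal ((F x - c) ^ 2) ∂μ ≤ 96 * (condenserSup μ * energy F) := by
    calc _ = ∫⁻ x, liminf (fun n => ENNReal.ofReal
          ((F (.vertex (proj G o (n + 1) x)) - c) ^ 2)) atTop ∂μ := by
          refine lintegral_congr_ae ?_
          filter_upwards [hF.ae_tendsto hG hμ o] with x hx
          exact (((ENNReal.continuous_ofReal.tendsto _).comp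
            ((hx.sub_const c).pow 2)).liminf_eq).symm
      _ ≤ liminf (fun n => ∫⁻ x, ENNReal.ofReal
          ((F (.vertex (proj G o (n + 1) x)) - c) ^ 2) ∂μ) atTop :=
          lintegral_liminf_le fun n => (((measurable_comp_proj hG o n fun v =>
            F (.vertex v)).sub_const c).pow_const 2).ennreal_ofReal
      _ ≤ _ := liminf_le_of_frequently_le' (Frequently.of_forall fun n =>
          lintegral_sq_sub_le_of_median hG hreg hμ o ho h0 hS F n)
  calc ∫⁻ x, ENNReal.ofReal (F x ^ 2) ∂μ
      ≤ ∫⁻ x, (ENNReal.ofReal (2 * c ^ 2) + 2 * ENNReal.ofReal ((F x - c) ^ 2)) ∂μ := by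
        refine lintegral_mono fun x => ?_
        rw [show (2 : ℝ≥0∞) = ENNReal.ofReal 2 by simp, ← ENNReal.ofReal_mul (by norm_num),
          ← ENNReal.ofReal_add (by positivity) (by positivity)]
        refine ENNReal.ofReal_le_ofReal ?_
        -- `2 c² + 2 (F - c)² - F² = (F - 2 c)²`
        nlinarith [sq_nonneg (F x - 2 * c)]
    _ = 2 * (1 * ENNReal.ofReal (c ^ 2)) + 2 * ∫⁻ x, ENNReal.ofReal ((F x - c) ^ 2) ∂μ := by
        rw [lintegral_add_left measurable_const, lintegral_const, measure_univ, mul_one,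
          lintegral_const_mul' _ _ ENNReal.ofNat_ne_top, ENNReal.ofReal_mul (by norm_num), one_mul]
        simp
    _ ≤ 2 * ((6 * condenserSup μ) * ENNReal.ofReal (c ^ 2)) +
        2 * (96 * (condenserSup μ * energy F)) := by gcongr
    _ = 12 * condenserSup μ * ENNReal.ofReal (c ^ 2) + 192 * condenserSup μ * energy F := by ring
    _ ≤ 192 * condenserSup μ * ENNReal.ofReal (c ^ 2) + 192 * condenserSup μ * energy F := by
        gcongr
        norm_num
    _ = _ := by rw [mul_add]

lemma iInf_hardyConst_le [G.LocallyFinite] [IsProbabilityMeasure μ] (hG : G.IsTree)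
    (hreg : G.IsRegularOfDegree 3) (hμ : ∀ v : V, μ {TBar.vertex v} = 0)
    (hdirac : ∀ ξ : Boundary G, μ ≠ Measure.dirac (TBar.bdry ξ)) :
    ⨅ o : V, hardyConst μ o ≤ 192 * condenserSup μ := by
  rcases eq_or_ne (condenserSup μ) ∞ with hS | hS
  · rw [hS, ENNReal.mul_top (by norm_num)]
    exact le_top
  obtain ⟨o, ho⟩ : ∃ o : V, ∀ d : G.Dart, d.fst = o → ¬ 1 < 2 * μ (TBar.bdry '' arc d) := by
    by_contra! hcon
    exact hS (condenserSup_eq_top_of_forall_exists hG hμ hdirac hcon)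
  refine iInf_le_of_le o (hardyConst_le_of_median hG hreg hμ o (fun d hd => ?_) hS)
  by_contra! hlt
  have h1 := ENNReal.add_lt_add_of_le_of_lt (ENNReal.mul_ne_top ENNReal.ofNat_ne_top
    (measure_ne_top μ _)) (not_lt.1 (ho d hd)) hlt
  rw [← mul_add, measure_arc_add_measure_arc_symm hG hμ] at h1
  norm_num at h1

end TreeHardy

theorem mainTheorem8 :
    ∃ C : ℝ≥0, 0 < C ∧
      ∀ (V : Type*) (G : SimpleGraph V) [G.LocallyFinite],
        G.IsTree → G.IsRegularOfDegree 3 →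
        ∀ (μ : MeasureTheory.Measure (TreeHardy.TBar G)) [MeasureTheory.IsProbabilityMeasure μ],
          (∀ v : V, μ {TreeHardy.TBar.vertex v} = 0) →
          (∀ ξ : TreeHardy.Boundary G, μ ≠ MeasureTheory.Measure.dirac (TreeHardy.TBar.bdry ξ)) →
          (TreeHardy.invHardyConst μ ≤ C * ⨅ o : V, TreeHardy.hardyConst μ o) ∧
          (⨅ o : V, TreeHardy.hardyConst μ o) ≤ C * TreeHardy.invHardyConst μ ∧
          (⨅ o : V, TreeHardy.hardyConst μ o) ≤ C * TreeHardy.condenserSup μ ∧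
          TreeHardy.condenserSup μ ≤ C * ⨅ o : V, TreeHardy.hardyConst μ o := by
  refine ⟨192, by norm_num, fun V G _ hG hreg μ _ hμ hdirac => ?_⟩
  have h1 : TreeHardy.invHardyConst μ ≤ ⨅ o : V, TreeHardy.hardyConst μ o :=
    le_iInf fun o => TreeHardy.invHardyConst_le_hardyConst hG hμ o
  have h2 : TreeHardy.condenserSup μ ≤ TreeHardy.invHardyConst μ :=
    TreeHardy.condenserSup_le_invHardyConst
  have h3 := TreeHardy.iInf_hardyConst_le hG hreg hμ hdirac
  have hC : ∀ x : ℝ≥0∞, x ≤ ((192 : ℝ≥0) : ℝ≥0∞) * x := fun x =>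
    le_mul_of_one_le_left' (by norm_num)
  exact ⟨h1.trans (hC _), h3.trans (mul_le_mul_right h2 _), h3, (h2.trans h1).trans (hC _)⟩
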